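/- Let $p$ be a prime, let $P$ be a finite $p$-group and let $R=\mathbb F_p$. A coefficient system on $P$ over $R$ is a contravariant functor from the orbit category of $P$ (objects the transitive $P$-sets $P/H$ for $H\le P$, morphisms the $P$-equivariant maps) to $R$-modules; write $L(H)$ for the value of $L$ at $P/H$. The coefficient systems on $P$ over $R$, with natural transformations as morphisms, form an abelian category $\mathrm{CS}_R(P)$. Let $f\colon C\to D$ be a map between two bounded complexes of projective objects (not necessarily finitely generated) of $\mathrm{CS}_R(P)$. If the map of complexes of $R$-modules $f(1)\colon C(1)\to D(1)$, obtained by evaluating at the trivial subgroup, is a quasi-isomorphism, i.e. induces an isomorphism in homology, then $f$ is a homotopy equivalence. -/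

import Mathlib

open CategoryTheory

universe v u w

/-- The orbit category of a group `G`. An object is a subgroup `H ≤ G`, standing for the orbit
`G ⧸ H`; see the `Category` instance below for the morphisms. -/
structure OrbitCat (G : Type u) [Group G] : Type u where
  /-- the subgroup `H` that represents the orbit `G ⧸ H` -/
  stab : Subgroup G

namespace OrbitCat

/-- Morphisms `K ⟶ H` are the `G`-equivariant maps `G ⧸ K → G ⧸ H`. Such a map is given by a coset
`gH` with `K ≤ gHg⁻¹`, the image of the trivial coset. -/
instance category (G : Type u) [Group G] : Category.{u} (OrbitCat G) where
  Hom K H := (G ⧸ K.stab) →[G] (G ⧸ H.stab)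
  id K := MulActionHom.id G
  comp f g := MulActionHom.comp g f

end OrbitCat

/-- The category `CS_R(G)` of coefficient systems on `G` over `R`: contravariant functors from
the orbit category of `G` to `R`-modules, with natural transformations as morphisms.
The restriction map `L(H) → L(K)`, for `K ≤ H`, is the value of `L` on the projection
`G ⧸ K → G ⧸ H`, and the conjugation map `c_{g,H} : L(H) → L(gHg⁻¹)` is its value on the map
`G ⧸ gHg⁻¹ → G ⧸ H` that sends `x(gHg⁻¹)` to `xgH`. -/
abbrev CoeffSystem (R : Type w) [Ring R] (G : Type u) [Group G] :=
  (OrbitCat G)ᵒᵖ ⥤ ModuleCat.{v} R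

/-- Evaluation `L ↦ L(H)` of coefficient systems at a subgroup `H`. -/
abbrev CoeffSystem.evalAt (R : Type w) [Ring R] {G : Type u} [Group G] (H : Subgroup G) :
    CoeffSystem.{v} R G ⥤ ModuleCat.{v} R :=
  (evaluation (OrbitCat G)ᵒᵖ (ModuleCat.{v} R)).obj (Opposite.op ⟨H⟩)

/-- A complex indexed by `ℤ` is bounded if its terms vanish outside some finite interval. -/
def IsBoundedComplex {A : Type*} [Category A] [Limits.HasZeroMorphisms A]
    (C : CochainComplex A ℤ) : Prop :=
  ∃ a b : ℤ, ∀ n : ℤ, n < a ∨ b < n → Limits.IsZero (C.X n)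

/-! Let `T` be the mapping cone of `f`, a bounded complex of projectives with `T(1)` acyclic. It
suffices that `T(H)` is acyclic for every `H`: then `T` is an acyclic bounded complex of
projectives, hence contractible, and `f` is a homotopy equivalence.

Acyclicity of `T(H)` goes by induction on `H`. If `H ≠ 1`, pick `K` normal of index `p` in `H` and
`g ∈ H` outside `K`; then `g` acts on `T(K)` with order `p`. A representable system takes at `K` the
value `𝔽_p[(P/L)^K]`, and its value at `H` is spanned by the `g`-fixed points of that basis. The
other orbits of `g` have length `p`, so `M(K)` is `M(H)` plus a free `𝔽_p[C_p]`-module. The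
elementwise form of this in `IsSmithPair` survives retracts, so it holds for all projectives
(`Projective.isSmithPair`).

With `N = 1 + g + ⋯ + g^(p-1)`, this gives `ker (g - 1) = M(H) ⊕ im N` and `ker N = M(H) ⊕ im (g -
1)`. The resulting exact sequences of complexes transfer acyclicity from `T(K)` to `T(H)`, as in
Smith theory (`IsSmithPair.exact_of_exact`). -/

/-! ### Smith theory for operators of order `p`. -/

/-- The norm operator `1 + g + ⋯ + g ^ (p - 1)`. -/
def LinearMap.normSum {k V : Type*} [Ring k] [AddCommGroup V] [Module k V] (p : ℕ)
    (g : V →ₗ[k] V) : V →ₗ[k] V :=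
  ∑ i ∈ Finset.range p, g ^ i

theorem LinearMap.normSum_apply {k V : Type*} [Ring k] [AddCommGroup V] [Module k V] (p : ℕ)
    (g : V →ₗ[k] V) (x : V) : g.normSum p x = ∑ i ∈ Finset.range p, (g ^ i) x := by
  simp [LinearMap.normSum]

theorem LinearMap.pow_apply_comm {k V V' : Type*} [Ring k] [AddCommGroup V] [Module k V]
    [AddCommGroup V'] [Module k V'] {g : V →ₗ[k] V} {g' : V' →ₗ[k] V'} {f : V →ₗ[k] V'}
    (h : ∀ x, f (g x) = g' (f x)) (n : ℕ) (x : V) : f ((g ^ n) x) = (g' ^ n) (f x) := by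
  induction n with
  | zero => rfl
  | succ n ih => rw [pow_succ', pow_succ', Module.End.mul_apply, Module.End.mul_apply, h, ih]

theorem LinearMap.normSum_apply_comm {k V V' : Type*} [Ring k] [AddCommGroup V] [Module k V]
    [AddCommGroup V'] [Module k V'] {g : V →ₗ[k] V} {g' : V' →ₗ[k] V'} {f : V →ₗ[k] V'}
    (h : ∀ x, f (g x) = g' (f x)) (p : ℕ) (x : V) :
    f (g.normSum p x) = g'.normSum p (f x) := by
  simp only [normSum_apply, map_sum, pow_apply_comm h]

theorem LinearMap.map_normSum {k V : Type*} [Ring k] [AddCommGroup V] [Module k V] {p : ℕ}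
    {g : V →ₗ[k] V} (h : ∀ x, (g ^ p) x = x) (x : V) : g (g.normSum p x) = g.normSum p x := by
  have h1 := Finset.sum_range_succ (fun i => (g ^ i) x) p
  rw [Finset.sum_range_succ', h] at h1
  simp only [LinearMap.normSum_apply, map_sum]
  simpa [pow_succ'] using h1

theorem LinearMap.normSum_map {k V : Type*} [Ring k] [AddCommGroup V] [Module k V] {p : ℕ}
    {g : V →ₗ[k] V} (h : ∀ x, (g ^ p) x = x) (x : V) : g.normSum p (g x) = g.normSum p x := by
  rw [← LinearMap.normSum_apply_comm (f := g) (fun _ => rfl), map_normSum h]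

/-- A linear map `ι : U → V` into a module with an operator `g` such that `g ^ p = 1` is a Smith
pair if `V` looks like the direct sum of `U`, with trivial action, and a module that is free over
the group ring of the cyclic group of order `p`, in characteristic `p`. -/
structure IsSmithPair {k U V : Type*} [Ring k] [AddCommGroup U] [Module k U] [AddCommGroup V]
    [Module k V] (p : ℕ) (ι : U →ₗ[k] V) (g : V →ₗ[k] V) : Prop where
  injective : Function.Injective ι
  map_ι : ∀ u, g (ι u) = ι u
  norm_ι : ∀ u, g.normSum p (ι u) = 0
  pow_eq : ∀ x, (g ^ p) x = x
  of_map_eq : ∀ x, g x = x → ∃ u y, x = ι u + g.normSum p y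
  of_norm_eq_zero : ∀ x, g.normSum p x = 0 → ∃ u y, x = ι u + (g y - y)
  eq_zero_of_norm : ∀ u y, ι u = g.normSum p y → u = 0
  eq_zero_of_sub : ∀ u y, ι u = g y - y → u = 0

namespace IsSmithPair

section

variable {k U V U' V' : Type*} [Ring k] [AddCommGroup U] [Module k U] [AddCommGroup V]
  [Module k V] [AddCommGroup U'] [Module k U'] [AddCommGroup V'] [Module k V']
  {p : ℕ} {ι : U →ₗ[k] V} {g : V →ₗ[k] V} {ι' : U' →ₗ[k] V'} {g' : V' →ₗ[k] V'}

theorem map_norm (h : IsSmithPair p ι g) (x : V) : g (g.normSum p x) = g.normSum p x :=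
  LinearMap.map_normSum h.pow_eq x

theorem norm_map (h : IsSmithPair p ι g) (x : V) : g.normSum p (g x) = g.normSum p x :=
  LinearMap.normSum_map h.pow_eq x

/-- A retract of a Smith pair is a Smith pair. -/
theorem of_retract (h : IsSmithPair p ι g) (iU : U' →ₗ[k] U) (rU : U →ₗ[k] U')
    (iV : V' →ₗ[k] V) (rV : V →ₗ[k] V') (hU : ∀ u, rU (iU u) = u) (hV : ∀ x, rV (iV x) = x)
    (hi : ∀ u, iV (ι' u) = ι (iU u)) (hr : ∀ u, rV (ι u) = ι' (rU u))
    (hgi : ∀ x, iV (g' x) = g (iV x)) (hgr : ∀ x, rV (g x) = g' (rV x)) :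
    IsSmithPair p ι' g' where
  injective := by
    intro a b hab
    have := congrArg iV hab
    rw [hi, hi] at this
    simpa [hU] using congrArg rU (h.injective this)
  map_ι u := by rw [← hV (g' _), hgi, hi, h.map_ι, ← hi, hV]
  norm_ι u := by rw [← hV (g'.normSum p _), LinearMap.normSum_apply_comm hgi, hi, h.norm_ι, map_zero]
  pow_eq x := by rw [← hV ((g' ^ p) x), LinearMap.pow_apply_comm hgi, h.pow_eq, hV]
  of_map_eq x hx := by
    obtain ⟨u, y, huy⟩ := h.of_map_eq (iV x) (by rw [← hgi, hx])
    refine ⟨rU u, rV y, ?_⟩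
    rw [← hV x, huy, map_add, hr, LinearMap.normSum_apply_comm hgr]
  of_norm_eq_zero x hx := by
    obtain ⟨u, y, huy⟩ := h.of_norm_eq_zero (iV x)
      (by rw [← LinearMap.normSum_apply_comm hgi, hx, map_zero])
    refine ⟨rU u, rV y, ?_⟩
    rw [← hV x, huy, map_add, hr, map_sub, hgr]
  eq_zero_of_norm u y huy := by
    rw [← hU u, h.eq_zero_of_norm (iU u) (iV y), map_zero]
    rw [← hi, huy, LinearMap.normSum_apply_comm hgi]
  eq_zero_of_sub u y huy := by
    rw [← hU u, h.eq_zero_of_sub (iU u) (iV y), map_zero]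
    rw [← hi, huy, map_sub, hgi]

end

/-- Smith theory: if `V` is a bounded below exact complex with an operator of order `p` and
`U n → V n` is a Smith pair in each degree, then the complex `U` is exact. -/
theorem exact_of_exact {k : Type*} [Ring k] {U V : ℤ → Type*} [∀ n, AddCommGroup (U n)]
    [∀ n, Module k (U n)] [∀ n, AddCommGroup (V n)] [∀ n, Module k (V n)] {p : ℕ}
    {ι : ∀ n, U n →ₗ[k] V n} {g : ∀ n, V n →ₗ[k] V n} (h : ∀ n, IsSmithPair p (ι n) (g n))
    (dU : ∀ n, U n →ₗ[k] U (n + 1)) (dV : ∀ n, V n →ₗ[k] V (n + 1))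
    (hdd : ∀ n x, dV (n + 1) (dV n x) = 0)
    (hι : ∀ n x, dV n (ι n x) = ι (n + 1) (dU n x)) (hg : ∀ n x, dV n (g n x) = g (n + 1) (dV n x))
    (hV : ∀ n x, dV (n + 1) x = 0 → ∃ y, x = dV n y) (a : ℤ) (ha : ∀ n < a, Subsingleton (V n))
    (n : ℤ) (u : U (n + 1)) (hu : dU (n + 1) u = 0) : ∃ u', u = dU n u' := by
  have hN : ∀ n x, dV n ((g n).normSum p x) = (g (n + 1)).normSum p (dV n x) :=
    fun n x => LinearMap.normSum_apply_comm (hg n) p x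
  -- The subcomplexes `im (g - 1)` and `im N` are proved exact together with `U`, by upward
  -- induction on the degree: each is a connecting-map shift of the other plus `U`.
  suffices H : ∀ n,
      ((∀ x, dV (n + 1) (g (n + 1) x - x) = 0 → ∃ y, g (n + 1) x - x = dV n (g n y - y)) ∧
      (∀ x, dV (n + 1) ((g (n + 1)).normSum p x) = 0 →
        ∃ y, (g (n + 1)).normSum p x = dV n ((g n).normSum p y))) ∧
      (∀ u, dU (n + 1) u = 0 → ∃ u', u = dU n u') from (H n).2 u hu
  have step : ∀ n,
      ((∀ x, dV (n + 1) (g (n + 1) x - x) = 0 → ∃ y, g (n + 1) x - x = dV n (g n y - y)) ∧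
      (∀ x, dV (n + 1) ((g (n + 1)).normSum p x) = 0 →
        ∃ y, (g (n + 1)).normSum p x = dV n ((g n).normSum p y))) →
      ((∀ x, dV (n + 1 + 1) (g (n + 1 + 1) x - x) = 0 →
        ∃ y, g (n + 1 + 1) x - x = dV (n + 1) (g (n + 1) y - y)) ∧
      (∀ x, dV (n + 1 + 1) ((g (n + 1 + 1)).normSum p x) = 0 →
        ∃ y, (g (n + 1 + 1)).normSum p x = dV (n + 1) ((g (n + 1)).normSum p y))) ∧
      (∀ u, dU (n + 1 + 1) u = 0 → ∃ u', u = dU (n + 1) u') := by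
    rintro n ⟨hA, hB⟩
    -- Exactness of `ker (g - 1) = U ⊕ im N`: a primitive `y` in `V` is corrected by a boundary,
    -- using `hA`, until it is `g`-invariant. `key'` does the same for `ker N`.
    have key : ∀ (u : U (n + 1 + 1)) (x : V (n + 1 + 1)),
        dV (n + 1 + 1) (ι _ u + (g _).normSum p x) = 0 → ∃ u' y,
          ι _ u + (g _).normSum p x = ι _ (dU _ u') + (g _).normSum p (dV _ y) := by
      intro u x hux
      obtain ⟨y, hy⟩ := hV _ _ hux
      obtain ⟨z, hz⟩ := hA y (by
        rw [map_sub, hg, ← hy, map_add, (h _).map_ι, (h _).map_norm, sub_self])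
      obtain ⟨u', x', hx'⟩ := (h (n + 1)).of_map_eq (y - dV n z) (by
        rw [map_sub, hg] at hz
        rwa [map_sub, ← sub_eq_sub_iff_sub_eq_sub])
      refine ⟨u', x', ?_⟩
      have := congrArg (dV (n + 1)) hx'
      rwa [map_sub, hdd, sub_zero, ← hy, map_add, hι, hN] at this
    have key' : ∀ (u : U (n + 1 + 1)) (x : V (n + 1 + 1)),
        dV (n + 1 + 1) (ι _ u + (g _ x - x)) = 0 → ∃ u' y,
          ι _ u + (g _ x - x) = ι _ (dU _ u') + (g _ (dV _ y) - dV _ y) := by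
      intro u x hux
      obtain ⟨y, hy⟩ := hV _ _ hux
      obtain ⟨z, hz⟩ := hB y (by
        rw [hN, ← hy, map_add, (h _).norm_ι, map_sub, (h _).norm_map, sub_self, add_zero])
      obtain ⟨u', x', hx'⟩ := (h (n + 1)).of_norm_eq_zero (y - dV n z) (by
        rw [map_sub, ← hN, hz, sub_self])
      refine ⟨u', x', ?_⟩
      have := congrArg (dV (n + 1)) hx'
      rwa [map_sub, hdd, sub_zero, ← hy, map_add, hι, map_sub, hg] at this
    refine ⟨⟨fun x hx => ?_, fun x hx => ?_⟩, fun u hu => ?_⟩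
    · obtain ⟨u', y, hy⟩ := key' 0 x (by simpa using hx)
      rw [map_zero, zero_add] at hy
      -- The sum `U ⊕ im (g - 1)` is direct, so the `U`-component of the primitive contributes
      -- nothing.
      have h0 : dU _ u' = 0 := (h _).eq_zero_of_sub _ (x - dV _ y) (by
        rw [map_sub, sub_sub_sub_comm, hy, add_sub_cancel_right])
      refine ⟨y, ?_⟩
      rw [hy, h0, map_zero, zero_add, map_sub, hg]
    · obtain ⟨u', y, hy⟩ := key 0 x (by simpa using hx)
      rw [map_zero, zero_add] at hy
      have h0 : dU _ u' = 0 := (h _).eq_zero_of_norm _ (x - dV _ y) (by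
        rw [map_sub, hy, add_sub_cancel_right])
      refine ⟨y, ?_⟩
      rw [hy, h0, map_zero, zero_add, hN]
    · obtain ⟨u', y, hy⟩ := key u 0 (by simp [hι, hu])
      rw [map_zero, add_zero] at hy
      refine ⟨u', sub_eq_zero.1 ((h _).eq_zero_of_norm _ (dV _ y) ?_)⟩
      rw [map_sub, hy, add_sub_cancel_left]
  have base : ∀ n, n + 1 < a →
      ((∀ x, dV (n + 1) (g (n + 1) x - x) = 0 → ∃ y, g (n + 1) x - x = dV n (g n y - y)) ∧
      (∀ x, dV (n + 1) ((g (n + 1)).normSum p x) = 0 →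
        ∃ y, (g (n + 1)).normSum p x = dV n ((g n).normSum p y))) ∧
      (∀ u, dU (n + 1) u = 0 → ∃ u', u = dU n u') := by
    intro n hn
    have := ha _ hn
    exact ⟨⟨fun x _ => ⟨0, Subsingleton.elim _ _⟩, fun x _ => ⟨0, Subsingleton.elim _ _⟩⟩,
      fun u _ => ⟨0, (h _).injective (Subsingleton.elim _ _)⟩⟩
  intro n
  rcases lt_or_ge (n + 1) a with hn | hn
  · exact base n hn
  -- At `n = a - 2` the degree concerned is `n + 1 = a - 1`, the last where `V` is known to vanish.
  · have hle : a - 2 ≤ n := by omega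
    clear hn hu u
    induction n, hle using Int.leInduction with
    | base => exact base _ (by omega)
    | succ m hm ih => exact step m ih.1

end IsSmithPair

/-! ### Cycles of a permutation of order `p`. -/

namespace Equiv.Perm

variable {X : Type*} (φ : Equiv.Perm X)

/-- A chosen representative of the cycle of `x`. -/
noncomputable def cycleRep (x : X) : X := (Quotient.mk (SameCycle.setoid φ) x).out

theorem sameCycle_cycleRep (x : X) : φ.SameCycle (φ.cycleRep x) x :=
  Quotient.mk_out (s := SameCycle.setoid φ) x

theorem SameCycle.cycleRep_eq {φ : Equiv.Perm X} {x y : X} (h : φ.SameCycle x y) :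
    φ.cycleRep x = φ.cycleRep y :=
  congrArg Quotient.out (Quotient.sound (s := SameCycle.setoid φ) h)

theorem cycleRep_cycleRep (x : X) : φ.cycleRep (φ.cycleRep x) = φ.cycleRep x :=
  (φ.sameCycle_cycleRep x).cycleRep_eq

theorem map_cycleRep_ne {x : X} (hx : φ x ≠ x) : φ (φ.cycleRep x) ≠ φ.cycleRep x := by
  obtain ⟨i, hi⟩ := φ.sameCycle_cycleRep x
  intro h
  rw [Function.IsFixedPt.perm_zpow h i] at hi
  exact hx (hi ▸ h)

variable {φ} {p : ℕ}

/-- The minimal period of `x` divides the prime `p` and is not `1`, so it is `p`. -/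
theorem pow_injOn_of_pow_prime_eq_one [hp : Fact p.Prime] (hφ : φ ^ p = 1) {x : X} (hx : φ x ≠ x) :
    Set.InjOn (fun i : ℕ => (φ ^ i) x) (Set.Iio p) := by
  have h := Function.minimalPeriod_eq_prime (f := φ) (x := x) (p := p)
    (by rw [Function.IsPeriodicPt, Function.IsFixedPt, ← Equiv.Perm.coe_pow, hφ]; rfl) hx
  have := Function.iterate_injOn_Iio_minimalPeriod (f := φ) (x := x)
  rw [h] at this
  simpa only [Equiv.Perm.coe_pow] using this

theorem SameCycle.exists_lt_of_pow_eq_one (hp : 0 < p) (hφ : φ ^ p = 1) {x y : X}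
    (h : φ.SameCycle x y) : ∃ i < p, (φ ^ i) x = y := by
  obtain ⟨i, hi⟩ := h
  refine ⟨(i % p).toNat, by have := Int.emod_lt_of_pos i (Int.natCast_pos.2 hp); omega, ?_⟩
  rw [← hi, ← zpow_natCast, Int.toNat_of_nonneg (Int.emod_nonneg _ (by omega))]
  conv_rhs => rw [← Int.emod_add_mul_ediv i p, zpow_add, zpow_mul, zpow_natCast, hφ]
  simp

end Equiv.Perm

/-! ### Permutation modules in characteristic `p`. -/

namespace Finsupp

open Equiv.Perm

variable {X Y : Type*} {p : ℕ} {k : Type*} [Ring k]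

theorem lmapDomain_pow_apply (φ : Equiv.Perm X) (n : ℕ) (f : X →₀ k) (x : X) :
    ((lmapDomain k k φ ^ n) f) ((φ ^ n) x) = f x := by
  induction n with
  | zero => rfl
  | succ n ih =>
    rw [pow_succ', pow_succ', Module.End.mul_apply, Equiv.Perm.mul_apply, lmapDomain_apply,
      mapDomain_apply φ.injective, ih]

theorem lmapDomain_pow_apply_of_fixed (φ : Equiv.Perm X) (n : ℕ) (f : X →₀ k) {x : X}
    (hx : φ x = x) : ((lmapDomain k k φ ^ n) f) x = f x := by
  conv_lhs => rw [← show (φ ^ n) x = x from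
    (Equiv.Perm.coe_pow φ n ▸ Function.iterate_fixed hx n :)]
  exact lmapDomain_pow_apply φ n f x

theorem normSum_lmapDomain_apply_of_fixed [CharP k p] (φ : Equiv.Perm X) (f : X →₀ k) {x : X}
    (hx : φ x = x) : ((lmapDomain k k φ).normSum p f) x = 0 := by
  rw [LinearMap.normSum_apply, finsetSum_apply]
  simp [lmapDomain_pow_apply_of_fixed φ _ f hx]

/-- Exactly one power `φ ^ i` with `i < p` carries the representative to `x`, and `f` vanishes on
the rest of the cycle. -/
theorem normSum_lmapDomain_apply_of_ne [hp : Fact p.Prime] {φ : Equiv.Perm X} (hφ : φ ^ p = 1)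
    (f : X →₀ k) (hf : ∀ x, φ.cycleRep x ≠ x → f x = 0) {x : X} (hx : φ x ≠ x) :
    ((lmapDomain k k φ).normSum p f) x = f (φ.cycleRep x) := by
  obtain ⟨i, hi, hix⟩ := (φ.sameCycle_cycleRep x).exists_lt_of_pow_eq_one hp.out.pos hφ
  have ht := φ.map_cycleRep_ne hx
  rw [LinearMap.normSum_apply, finsetSum_apply, Finset.sum_eq_single_of_mem i (by simpa using hi)]
  · conv_lhs => rw [← hix]
    exact lmapDomain_pow_apply φ i f _
  · intro j hj hji
    obtain ⟨y, hy⟩ := (φ ^ j).surjective x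
    rw [← hy, lmapDomain_pow_apply]
    refine hf y fun hyy => hji ?_
    have hcy : φ.SameCycle y x := ⟨j, by simpa using hy⟩
    rw [hcy.cycleRep_eq] at hyy
    refine pow_injOn_of_pow_prime_eq_one hφ ht (by simpa using hj) (by simpa using hi) ?_
    change (φ ^ j) (φ.cycleRep x) = (φ ^ i) (φ.cycleRep x)
    rw [hix, hyy, hy]

/-- Modulo `im (φ - 1)`, a basis element may be slid along its cycle; the differences telescope. -/
theorem exists_sub_cycleRep [hp : Fact p.Prime] {φ : Equiv.Perm X} (hφ : φ ^ p = 1) (f : X →₀ k) :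
    ∃ f', f = lmapDomain k k φ.cycleRep f + (lmapDomain k k φ f' - f') := by
  induction f using Finsupp.induction_linear with
  | zero => exact ⟨0, by simp⟩
  | add f g hf hg =>
    obtain ⟨f', hf⟩ := hf
    obtain ⟨g', hg⟩ := hg
    refine ⟨f' + g', ?_⟩
    conv_lhs => rw [hf, hg]
    simp only [map_add]
    abel
  | single x a =>
    obtain ⟨i, -, hi⟩ := (φ.sameCycle_cycleRep x).exists_lt_of_pow_eq_one hp.out.pos hφ
    suffices H : ∀ (i : ℕ) (y : X), ∃ f', single ((φ ^ i) y) a =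
        single y a + (lmapDomain k k φ f' - f') by
      obtain ⟨f', hf⟩ := H i (φ.cycleRep x)
      exact ⟨f', by rwa [hi, ← mapDomain_single (f := φ.cycleRep) (a := x)] at hf⟩
    intro i y
    induction i with
    | zero => exact ⟨0, by simp⟩
    | succ i ih =>
      obtain ⟨f', hf⟩ := ih
      refine ⟨f' + single ((φ ^ i) y) a, ?_⟩
      rw [map_add, lmapDomain_apply _ _ _ (single _ _), mapDomain_single, pow_succ',
        Equiv.Perm.mul_apply]
      conv_rhs => rw [add_sub_add_comm, ← add_assoc, ← hf]
      abel

theorem lmapDomain_comapDomain {ι : Y → X} (hι : Function.Injective ι) (f : X →₀ k)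
    (hf : ∀ x, f x ≠ 0 → x ∈ Set.range ι) :
    lmapDomain k k ι (f.comapDomain ι hι.injOn) = f :=
  mapDomain_comapDomain ι hι f fun x hx => hf x (by simpa using hx)

/-- Permutation modules of a cyclic group of order `p` in characteristic `p`, with the span of
the fixed points, are Smith pairs. -/
theorem isSmithPair_lmapDomain [hp : Fact p.Prime] [CharP k p] {φ : Equiv.Perm X} (hφ : φ ^ p = 1)
    {ι : Y → X} (hι : Function.Injective ι) (hr : ∀ x, x ∈ Set.range ι ↔ φ x = x) :
    IsSmithPair p (lmapDomain k k ι) (lmapDomain k k φ) := by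
  have hfix : ∀ u, lmapDomain k k φ (lmapDomain k k ι u) = lmapDomain k k ι u := fun u => by
    rw [← LinearMap.comp_apply, ← lmapDomain_comp]
    congr 2
    exact funext fun y => (hr _).1 ⟨y, rfl⟩
  have hpow : ∀ f, (lmapDomain k k φ ^ p) f = f := fun f => by
    ext x
    conv_lhs => rw [← show (φ ^ p) x = x by rw [hφ]; rfl]
    exact lmapDomain_pow_apply φ p f x
  exact
  { injective := mapDomain_injective hι
    map_ι := hfix
    norm_ι u := by
      have h1 : ∀ i : ℕ, (lmapDomain k k φ ^ i) (lmapDomain k k ι u) = lmapDomain k k ι u := by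
        intro i
        induction i with
        | zero => rfl
        | succ i ih => rw [pow_succ', Module.End.mul_apply, ih, hfix]
      rw [LinearMap.normSum_apply, Finset.sum_congr rfl fun i _ => h1 i]
      ext x
      simp
    pow_eq := hpow
    of_map_eq f hf := by
      classical
      -- An invariant `f` is constant on cycles; off the fixed points it is the norm of its
      -- restriction to the representatives.
      refine ⟨f.comapDomain ι hι.injOn, f.filter fun x => φ.cycleRep x = x ∧ φ x ≠ x, ?_⟩
      have hf1 : ∀ x, f (φ x) = f x := fun x => by
        conv_lhs => rw [← hf, lmapDomain_apply, mapDomain_apply φ.injective]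
      have hfn : ∀ (i : ℕ) x, f ((φ ^ i) x) = f x := fun i x => by
        induction i with
        | zero => rfl
        | succ i ih => rw [pow_succ', Equiv.Perm.mul_apply, hf1, ih]
      ext x
      by_cases hx : φ x = x
      · obtain ⟨y, rfl⟩ := (hr x).2 hx
        rw [add_apply, normSum_lmapDomain_apply_of_fixed φ _ hx, lmapDomain_apply,
          mapDomain_apply hι, comapDomain_apply, add_zero]
      · obtain ⟨i, -, hi⟩ := (φ.sameCycle_cycleRep x).exists_lt_of_pow_eq_one hp.out.pos hφ
        rw [add_apply, lmapDomain_apply, mapDomain_of_notMem_range _ _ (mt (hr x).1 hx), zero_add,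
          normSum_lmapDomain_apply_of_ne hφ _ (fun y hy => filter_apply_neg _ _ (by simp [hy])) hx,
          filter_apply_pos, ← hfn i (φ.cycleRep x), hi]
        exact ⟨φ.cycleRep_cycleRep x, φ.map_cycleRep_ne hx⟩
    of_norm_eq_zero f hf := by
      obtain ⟨f', hf'⟩ := exists_sub_cycleRep hφ f
      -- After sliding to representatives, the norm reads off each value on a free cycle; as it is
      -- zero, only fixed points remain in the support.
      refine ⟨(lmapDomain k k φ.cycleRep f).comapDomain ι hι.injOn, f', ?_⟩
      rw [lmapDomain_comapDomain hι, ← hf']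
      intro x hx0
      rw [hr]
      by_contra hx
      apply hx0
      have hr0 : ∀ x, φ.cycleRep x ≠ x → lmapDomain k k φ.cycleRep f x = 0 := fun x hx =>
        mapDomain_of_notMem_range _ _ fun ⟨y, hy⟩ => hx (by rw [← hy, cycleRep_cycleRep])
      by_cases hxr : φ.cycleRep x = x
      · have hN : (lmapDomain k k φ).normSum p (lmapDomain k k φ.cycleRep f) = 0 := by
          rwa [hf', map_add, map_sub, LinearMap.normSum_map hpow, sub_self, add_zero] at hf
        have := DFunLike.congr_fun hN x
        rwa [normSum_lmapDomain_apply_of_ne hφ _ hr0 hx, hxr] at this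
      · exact hr0 x hxr
    eq_zero_of_norm u f h := by
      ext y
      have := DFunLike.congr_fun h (ι y)
      rwa [normSum_lmapDomain_apply_of_fixed φ _ ((hr _).1 ⟨y, rfl⟩), lmapDomain_apply,
        mapDomain_apply hι] at this
    eq_zero_of_sub u f h := by
      ext y
      have := DFunLike.congr_fun h (ι y)
      have h1 := lmapDomain_pow_apply_of_fixed φ 1 f ((hr _).1 ⟨y, rfl⟩)
      rw [pow_one] at h1
      rwa [sub_apply, h1, sub_self, lmapDomain_apply, mapDomain_apply hι] at this }

theorem isSmithPair_lmapDomain_of_iterate [hp : Fact p.Prime] [CharP k p] {φ : X → X}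
    (hφ : φ^[p] = id) {ι : Y → X} (hι : Function.Injective ι)
    (hr : ∀ x, x ∈ Set.range ι ↔ φ x = x) :
    IsSmithPair p (lmapDomain k k ι) (lmapDomain k k φ) := by
  have h : p - 1 + 1 = p := Nat.sub_add_cancel hp.out.one_le
  let e : Equiv.Perm X :=
    { toFun := φ
      invFun := φ^[p - 1]
      left_inv x := by
        have := congrFun hφ x
        rwa [← h, Function.iterate_succ_apply] at this
      right_inv x := by
        have := congrFun hφ x
        rwa [← h, Function.iterate_succ_apply'] at this }
  refine isSmithPair_lmapDomain (φ := e) ?_ hι hr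
  ext x
  rw [Equiv.Perm.coe_pow]
  exact congrFun hφ x

end Finsupp

/-! ### Projective presheaves as retracts of sums of representables. -/

namespace CategoryTheory

open Opposite

variable {C : Type u} [Category.{w} C]

/-- The conditions on an endomorphism `γ : a ⟶ a` and on `π : a ⟶ b` which express that `γ ^ p = 1`
and that `π` is the quotient of `a` by the action of `γ`. -/
structure IsCyclicQuotient (p : ℕ) {a b : C} (γ : End a) (π : a ⟶ b) : Prop where
  pow_eq : γ ^ p = 1
  epi : Epi π
  fixed_iff : ∀ {c : C} (h : a ⟶ c), (γ : a ⟶ a) ≫ h = h ↔ ∃ h', π ≫ h' = h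

section

variable [Small.{v} C] [∀ a b : C, Small.{v} (a ⟶ b)] {k : Type} [Ring k]
  (M : Cᵒᵖ ⥤ ModuleCat.{v} k)

/-- The values at `a` of the sum of the representable presheaves of sets on `C`, one for each
element of `M`. -/
abbrev PresheafCell (a : C) : Type v :=
  Shrink.{v} (Σ c : C, (a ⟶ c) × M.obj (op c))

namespace PresheafCell

variable {M}

/-- The restriction maps of the presheaf `PresheafCell M`. -/
noncomputable def map {a b : C} (f : a ⟶ b) (x : PresheafCell M b) : PresheafCell M a :=
  equivShrink _ ⟨((equivShrink _).symm x).1, f ≫ ((equivShrink _).symm x).2.1,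
    ((equivShrink _).symm x).2.2⟩

theorem map_mk {a b c : C} (f : a ⟶ b) (h : b ⟶ c) (m : M.obj (op c)) :
    map f (equivShrink (Σ c : C, (b ⟶ c) × M.obj (op c)) ⟨c, h, m⟩) =
      equivShrink _ ⟨c, f ≫ h, m⟩ := by
  rw [map, Equiv.symm_apply_apply]

theorem exists_mk {a : C} (x : PresheafCell M a) :
    ∃ (c : C) (h : a ⟶ c) (m : M.obj (op c)), x = equivShrink _ ⟨c, h, m⟩ :=
  ⟨_, _, _, ((equivShrink _).apply_symm_apply x).symm⟩

theorem mk_injective {a c : C} {h h' : a ⟶ c} {m m' : M.obj (op c)}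
    (e : equivShrink (Σ c : C, (a ⟶ c) × M.obj (op c)) ⟨c, h, m⟩ = equivShrink _ ⟨c, h', m'⟩) :
    h = h' ∧ m = m' := by
  simpa using e

theorem map_id (a : C) : map (𝟙 a) = (id : PresheafCell M a → _) := by
  funext x
  obtain ⟨c, h, m, rfl⟩ := exists_mk x
  rw [map_mk, Category.id_comp, id]

/-- The element of `M` that a cell maps to. -/
noncomputable def eval {a : C} (x : PresheafCell M a) : M.obj (op a) :=
  (fun y : Σ c : C, (a ⟶ c) × M.obj (op c) => (M.map y.2.1.op).hom y.2.2) ((equivShrink _).symm x)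

theorem eval_mk {a c : C} (h : a ⟶ c) (m : M.obj (op c)) :
    eval (equivShrink (Σ c : C, (a ⟶ c) × M.obj (op c)) ⟨c, h, m⟩) = (M.map h.op).hom m := by
  rw [eval, Equiv.symm_apply_apply]

theorem eval_map {a b : C} (f : a ⟶ b) (x : PresheafCell M b) :
    eval (map f x) = (M.map f.op).hom (eval x) := by
  obtain ⟨c, h, m, rfl⟩ := exists_mk x
  rw [map_mk, eval_mk, eval_mk, op_comp, M.map_comp, ModuleCat.comp_apply]

theorem map_comp {a b c : C} (f : a ⟶ b) (g : b ⟶ c) :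
    map (f ≫ g) = (map f ∘ map g : PresheafCell M c → _) := by
  funext x
  obtain ⟨c, h, m, rfl⟩ := exists_mk x
  rw [Function.comp, map_mk, map_mk, map_mk, Category.assoc]

theorem map_pow {a : C} (γ : End a) (n : ℕ) :
    map (γ ^ n : End a) = (map (γ : a ⟶ a) : PresheafCell M a → _)^[n] := by
  induction n with
  | zero => exact map_id a
  | succ n ih => rw [pow_succ', Function.iterate_succ, ← ih]; exact map_comp _ _

/-- Precomposition with the epimorphism `π` is injective on cells, and its image is the set of
`γ`-fixed cells by the quotient property. -/
theorem isSmithPair {p : ℕ} [Fact p.Prime] [CharP k p] {a b : C} {γ : End a} {π : a ⟶ b}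
    (h : IsCyclicQuotient p γ π) :
    IsSmithPair p (Finsupp.lmapDomain k k (map π : PresheafCell M b → _))
      (Finsupp.lmapDomain k k (map (γ : a ⟶ a) : PresheafCell M a → _)) := by
  have := h.epi
  refine Finsupp.isSmithPair_lmapDomain_of_iterate ?_ ?_ ?_
  · rw [← map_pow, h.pow_eq]
    exact map_id a
  · intro x y hxy
    obtain ⟨c, f, m, rfl⟩ := exists_mk x
    obtain ⟨c', f', m', rfl⟩ := exists_mk y
    rw [map_mk, map_mk] at hxy
    obtain rfl : c = c' := congrArg Sigma.fst ((equivShrink _).injective hxy)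
    obtain ⟨h1, rfl⟩ := mk_injective hxy
    rw [(cancel_epi π).1 h1]
  · intro x
    obtain ⟨c, f, m, rfl⟩ := exists_mk x
    rw [map_mk]
    constructor
    · rintro ⟨y, hy⟩
      obtain ⟨c', f', m', rfl⟩ := exists_mk y
      rw [map_mk] at hy
      obtain rfl : c' = c := congrArg Sigma.fst ((equivShrink _).injective hy)
      obtain ⟨h1, rfl⟩ := mk_injective hy
      rw [(h.fixed_iff f).2 ⟨f', h1⟩]
    · intro hx
      obtain ⟨f', rfl⟩ := (h.fixed_iff f).1 (mk_injective hx).1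
      exact ⟨equivShrink _ ⟨c, f', m⟩, map_mk _ _ _⟩

end PresheafCell

/-- A sum of linearized representable functors that covers `M`. -/
noncomputable def freeCover : Cᵒᵖ ⥤ ModuleCat.{v} k where
  obj a := ModuleCat.of k (PresheafCell M a.unop →₀ k)
  map f := ModuleCat.ofHom (Finsupp.lmapDomain k k (PresheafCell.map f.unop))
  map_id a := by
    rw [unop_id, PresheafCell.map_id, Finsupp.lmapDomain_id]
    rfl
  map_comp f g := by
    rw [unop_comp, PresheafCell.map_comp, Finsupp.lmapDomain_comp]
    rfl

/-- The projection of `freeCover M` onto `M`. -/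
noncomputable def freeCoverπ : freeCover M ⟶ M where
  app a := ModuleCat.ofHom
    (Finsupp.linearCombination k (PresheafCell.eval : PresheafCell M a.unop → M.obj a))
  naturality a b f := by
    refine ModuleCat.hom_ext (Finsupp.lhom_ext' fun x => LinearMap.ext_ring ?_)
    change Finsupp.linearCombination k (PresheafCell.eval : PresheafCell M b.unop → M.obj b)
        (Finsupp.mapDomain (PresheafCell.map f.unop) (Finsupp.single x 1)) =
      (M.map f).hom (Finsupp.linearCombination k
        (PresheafCell.eval : PresheafCell M a.unop → M.obj a) (Finsupp.single x 1))
    rw [Finsupp.mapDomain_single, Finsupp.linearCombination_single,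
      Finsupp.linearCombination_single, one_smul, one_smul]
    exact PresheafCell.eval_map f.unop x

instance : Epi (freeCoverπ M) := by
  have : ∀ a, Epi ((freeCoverπ M).app a) := fun a => by
    rw [ModuleCat.epi_iff_surjective]
    intro m
    refine ⟨Finsupp.single (equivShrink _ ⟨a.unop, 𝟙 _, m⟩) 1, ?_⟩
    refine (Finsupp.linearCombination_single _ _ _).trans ?_
    rw [one_smul, PresheafCell.eval_mk, op_id, M.map_id]
    rfl
  exact NatTrans.epi_of_epi_app _

theorem isSmithPair_freeCover {p : ℕ} [Fact p.Prime] [CharP k p] {a b : C}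
    {γ : End a} {π : a ⟶ b} (h : IsCyclicQuotient p γ π) :
    IsSmithPair p ((freeCover M).map π.op).hom
      ((freeCover M).map (Quiver.Hom.op (γ : a ⟶ a))).hom :=
  PresheafCell.isSmithPair h

end

theorem IsSmithPair.of_retract_functor {k : Type*} [Ring k] {M F : Cᵒᵖ ⥤ ModuleCat.{v} k}
    (s : M ⟶ F) (r : F ⟶ M) (hs : s ≫ r = 𝟙 M) {p : ℕ} {a b : Cᵒᵖ} {γ : a ⟶ a} {π : b ⟶ a}
    (h : IsSmithPair p (F.map π).hom (F.map γ).hom) :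
    IsSmithPair p (M.map π).hom (M.map γ).hom :=
  h.of_retract (s.app b).hom (r.app b).hom (s.app a).hom (r.app a).hom
    (fun x => congrArg (fun t : M ⟶ M => (t.app b).hom x) hs)
    (fun x => congrArg (fun t : M ⟶ M => (t.app a).hom x) hs)
    (fun u => NatTrans.naturality_apply s π u) (fun u => NatTrans.naturality_apply r π u)
    (fun u => NatTrans.naturality_apply s γ u) (fun u => NatTrans.naturality_apply r γ u)

theorem Projective.isSmithPair [Small.{v} C] [∀ a b : C, Small.{v} (a ⟶ b)] {k : Type} [Ring k]
    (M : Cᵒᵖ ⥤ ModuleCat.{v} k) [Projective M] {p : ℕ} [Fact p.Prime] [CharP k p] {a b : C}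
    {γ : End a} {π : a ⟶ b} (h : IsCyclicQuotient p γ π) :
    IsSmithPair p (M.map π.op).hom (M.map (Quiver.Hom.op (γ : a ⟶ a))).hom :=
  IsSmithPair.of_retract_functor _ _ (Projective.factorThru_comp (𝟙 M) (freeCoverπ M))
    (isSmithPair_freeCover M h)

end CategoryTheory

/-! ### Index `p` subgroups and quotients of orbits. -/

theorem Subgroup.exists_normal_index_eq_prime {p : ℕ} [hp : Fact p.Prime] {G : Type*} [Group G]
    [Finite G] [Nontrivial G] (hG : IsPGroup p G) :
    ∃ (K : Subgroup G) (g : G), K.Normal ∧ g ^ p ∈ K ∧ g ∉ K ∧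
      ∀ S : Subgroup G, K ≤ S → g ∈ S → S = ⊤ := by
  obtain ⟨n, hn, hcard⟩ := hG.nontrivial_iff_card.1 inferInstance
  obtain ⟨n, rfl⟩ := Nat.exists_eq_add_one.2 hn
  obtain ⟨K, hK⟩ := Sylow.exists_subgroup_card_pow_prime (G := G) p (n := n)
    (hcard ▸ pow_dvd_pow p n.le_succ)
  have hindex : K.index = p := by
    have := K.card_mul_index
    rw [hK, hcard, pow_succ] at this
    exact Nat.eq_of_mul_eq_mul_left (pow_pos hp.out.pos n) this
  have hnormal : K.Normal := Subgroup.normal_of_index_eq_minFac_card (by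
    rw [hindex, hcard, hp.out.pow_minFac n.succ_ne_zero])
  obtain ⟨g, hg⟩ : ∃ g, g ∉ K := by
    by_contra! h
    rw [(eq_top_iff' K).2 h, index_top] at hindex
    exact hp.out.one_lt.ne hindex
  refine ⟨K, g, hnormal, hindex ▸ K.pow_index_mem g, hg, fun S hS hgS => ?_⟩
  rcases (Nat.dvd_prime hp.out).1 (hindex ▸ Subgroup.index_dvd_of_le hS) with h | h
  · exact Subgroup.index_eq_one.1 h
  · refine absurd (?_ : S ≤ K) fun h => hg (h hgS)
    have h1 := K.card_mul_index
    rw [hindex, ← S.card_mul_index, h] at h1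
    exact (Subgroup.eq_of_le_of_card_ge hS
      (Nat.eq_of_mul_eq_mul_right hp.out.pos h1).ge).ge

namespace OrbitCat

variable {G : Type u} [Group G]

theorem hom_apply_mk {K L : OrbitCat G} (f : K ⟶ L) (x : G) :
    f.toFun (x : G ⧸ K.stab) = x • f.toFun ((1 : G) : G ⧸ K.stab) := by
  have h : (x : G ⧸ K.stab) = x • ((1 : G) : G ⧸ K.stab) := by
    rw [MulAction.Quotient.smul_coe, smul_eq_mul, mul_one]
  rw [h]
  exact f.map_smul' x _

theorem hom_ext_one {K L : OrbitCat G} {f f' : K ⟶ L}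
    (h : f.toFun ((1 : G) : G ⧸ K.stab) = f'.toFun ((1 : G) : G ⧸ K.stab)) : f = f' := by
  refine MulActionHom.ext fun x => ?_
  induction x using QuotientGroup.induction_on with
  | H x => exact (hom_apply_mk f x).trans ((congrArg _ h).trans (hom_apply_mk f' x).symm)

/-- The equivariant map `G ⧸ K → G ⧸ L` with a given value at the trivial coset. -/
def homMk {K L : OrbitCat G} (y : G ⧸ L.stab) (hy : K.stab ≤ MulAction.stabilizer G y) :
    K ⟶ L where
  toFun x := Quotient.liftOn' x (fun x => x • y) fun a b hab => by
    have := hy (QuotientGroup.leftRel_apply.1 hab)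
    rw [MulAction.mem_stabilizer_iff, mul_smul, inv_smul_eq_iff] at this
    exact this.symm
  map_smul' g x := by
    induction x using QuotientGroup.induction_on with
    | H x => exact mul_smul g x y

theorem homMk_one {K L : OrbitCat G} (y : G ⧸ L.stab) (hy : K.stab ≤ MulAction.stabilizer G y) :
    (homMk y hy).toFun ((1 : G) : G ⧸ K.stab) = y :=
  one_smul G y

theorem le_stabilizer {K L : OrbitCat G} (f : K ⟶ L) :
    K.stab ≤ MulAction.stabilizer G (f.toFun ((1 : G) : G ⧸ K.stab)) := by
  intro x hx
  rw [MulAction.mem_stabilizer_iff, ← hom_apply_mk]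
  congr 1
  exact (QuotientGroup.eq.2 (by simpa using hx)).symm

/-- Finiteness supplies the smallness conditions of `Projective.isSmithPair`. -/
instance [Finite G] : Finite (OrbitCat G) :=
  Finite.of_injective OrbitCat.stab fun ⟨_⟩ ⟨_⟩ h => congrArg _ h

instance [Finite G] (K L : OrbitCat G) : Finite (K ⟶ L) :=
  Finite.of_injective (fun f => f.toFun ((1 : G) : G ⧸ K.stab)) fun _ _ h => hom_ext_one h

/-- Take `γ : xK ↦ xgK`, with `K` normal in `H`. A `γ`-invariant map out of `G ⧸ K` sends the
trivial coset to a point fixed by `K` and `g`, hence by `H`, so it factors through `G ⧸ H`. -/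
theorem exists_isCyclicQuotient {p : ℕ} [Fact p.Prime] [Finite G] (hG : IsPGroup p G)
    (H : Subgroup G) (hH : H ≠ ⊥) :
    ∃ (K : Subgroup G) (γ : End (⟨K⟩ : OrbitCat G)) (π : (⟨K⟩ : OrbitCat G) ⟶ ⟨H⟩),
      K < H ∧ IsCyclicQuotient p γ π := by
  have := (Subgroup.nontrivial_iff_ne_bot H).2 hH
  obtain ⟨K', g, hK', hgp, hg, htop⟩ := Subgroup.exists_normal_index_eq_prime (hG.to_subgroup H)
  let K := K'.map H.subtype
  have hKH : K ≤ H := Subgroup.map_subtype_le K'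
  have hmem : ∀ x : H, (x : G) ∈ K ↔ x ∈ K' := fun x =>
    Subgroup.mem_map_iff_mem H.subtype_injective
  have hgen : ∀ S : Subgroup G, K ≤ S → (g : G) ∈ S → H ≤ S := by
    intro S hKS hgS
    have := htop (S.subgroupOf H) (fun x hx => hKS ((hmem x).2 hx)) hgS
    rwa [Subgroup.subgroupOf_eq_top] at this
  let γ : (⟨K⟩ : OrbitCat G) ⟶ ⟨K⟩ := homMk ((g : G) : G ⧸ K) (by
    rintro _ ⟨x, hx, rfl⟩
    refine (QuotientGroup.eq.2 ?_)
    have := (hmem (g⁻¹ * x⁻¹ * g)).2 (by simpa using hK'.conj_mem x⁻¹ (inv_mem hx) g⁻¹)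
    simpa using this)
  let π : (⟨K⟩ : OrbitCat G) ⟶ ⟨H⟩ := homMk ((1 : G) : G ⧸ H) (by
    intro x hx
    refine (QuotientGroup.eq.2 ?_)
    simpa using hKH hx)
  have hγ1 : γ.toFun ((1 : G) : G ⧸ K) = ((g : G) : G ⧸ K) := homMk_one _ _
  have hπ1 : π.toFun ((1 : G) : G ⧸ K) = ((1 : G) : G ⧸ H) := homMk_one _ _
  have hγh : ∀ {c : OrbitCat G} (h : (⟨K⟩ : OrbitCat G) ⟶ c),
      (γ ≫ h).toFun ((1 : G) : G ⧸ K) = (g : G) • h.toFun ((1 : G) : G ⧸ K) := fun h =>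
    (congrArg h.toFun hγ1).trans (hom_apply_mk h _)
  have hπh : ∀ {c : OrbitCat G} (h : (⟨H⟩ : OrbitCat G) ⟶ c),
      (π ≫ h).toFun ((1 : G) : G ⧸ K) = h.toFun ((1 : G) : G ⧸ H) := fun h =>
    congrArg h.toFun hπ1
  refine ⟨K, γ, π, lt_of_le_of_ne hKH fun h => hg ((hmem g).1 (h.symm.le g.2)), ?_, ?_, ?_⟩
  · let γ' : End (⟨K⟩ : OrbitCat G) := γ
    have hpow : ∀ n : ℕ, MulActionHom.toFun (γ' ^ n) ((1 : G) : G ⧸ K) =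
        (((g : G) ^ n : G) : G ⧸ K) := by
      intro n
      induction n with
      | zero =>
        rw [pow_zero, pow_zero]
        rfl
      | succ n ih =>
        rw [pow_succ, pow_succ']
        exact (hγh _).trans (congrArg _ ih)
    refine hom_ext_one ((hpow p).trans ?_)
    exact (QuotientGroup.eq.2 (by simpa using (hmem _).2 hgp)).symm
  · refine ⟨fun f f' h => hom_ext_one ?_⟩
    rw [← hπh, ← hπh, h]
  · intro c h
    constructor
    · intro hh
      refine ⟨homMk (h.toFun ((1 : G) : G ⧸ K)) (hgen _ (le_stabilizer h) ?_), ?_⟩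
      · rw [MulAction.mem_stabilizer_iff, ← hγh, hh]
      · exact hom_ext_one ((hπh _).trans (homMk_one _ _))
    · rintro ⟨h', rfl⟩
      refine hom_ext_one ?_
      rw [hγh, hπh]
      exact le_stabilizer h' g.2

end OrbitCat

/-! ### Acyclicity at all subgroups, and mapping cones. -/

theorem HomologicalComplex.acyclic_iff_moduleCat {k : Type*} [Ring k]
    (T : CochainComplex (ModuleCat.{v} k) ℤ) :
    T.Acyclic ↔ ∀ (n : ℤ) (x : T.X (n + 1)), (T.d (n + 1) (n + 1 + 1)).hom x = 0 →
      ∃ y, x = (T.d n (n + 1)).hom y := by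
  have h : ∀ n : ℤ, T.ExactAt (n + 1) ↔ ∀ x : T.X (n + 1),
      (T.d (n + 1) (n + 1 + 1)).hom x = 0 → ∃ y, x = (T.d n (n + 1)).hom y := fun n => by
    rw [T.exactAt_iff' n (n + 1) (n + 1 + 1) (by simp) (by simp), ShortComplex.moduleCat_exact_iff]
    exact forall₂_congr fun x _ => exists_congr fun y => eq_comm
  refine ⟨fun hT n => (h n).1 (hT (n + 1)), fun hT n => ?_⟩
  rw [← sub_add_cancel n 1]
  exact (h _).2 (hT _)

/-- A bounded below complex of projective coefficient systems of a `p`-group in characteristic `p`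
is acyclic at every subgroup if it is acyclic at the trivial one. -/
theorem CoeffSystem.acyclic_evalAt {p : ℕ} [Fact p.Prime] {P : Type u} [Group P] [Finite P]
    (hP : IsPGroup p P) (T : CochainComplex (CoeffSystem.{v} (ZMod p) P) ℤ) (a : ℤ)
    (ha : ∀ n < a, Limits.IsZero (T.X n)) (hT : ∀ n, Projective (T.X n))
    (h : (((evalAt (ZMod p) (⊥ : Subgroup P)).mapHomologicalComplex _).obj T).Acyclic)
    (H : Subgroup P) : (((evalAt (ZMod p) H).mapHomologicalComplex _).obj T).Acyclic := by
  induction H using WellFoundedLT.induction with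
  | ind H ih =>
    by_cases hH : H = ⊥
    · rwa [hH]
    obtain ⟨K, γ, π, hKH, hq⟩ := OrbitCat.exists_isCyclicQuotient hP H hH
    have hK := ih K hKH
    rw [HomologicalComplex.acyclic_iff_moduleCat] at hK ⊢
    refine IsSmithPair.exact_of_exact (fun n => Projective.isSmithPair (T.X n) hq)
      (fun n => ((T.d n (n + 1)).app (.op ⟨H⟩)).hom) (fun n => ((T.d n (n + 1)).app (.op ⟨K⟩)).hom)
      ?_ ?_ ?_ hK a ?_
    · intro n x
      exact congrArg (fun t : T.X n ⟶ T.X (n + 1 + 1) => (t.app (.op ⟨K⟩)).hom x)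
        (T.d_comp_d n (n + 1) (n + 1 + 1))
    · exact fun n x => (NatTrans.naturality_apply (T.d n (n + 1)) π.op x)
    · exact fun n x => (NatTrans.naturality_apply (T.d n (n + 1)) γ.op x)
    · intro n hn
      exact ModuleCat.subsingleton_of_isZero
        (Functor.map_isZero (evalAt (ZMod p) K) (ha n hn))

theorem CochainComplex.acyclic_mappingCone_iff {A : Type*} [Category* A] [Abelian A]
    {C D : CochainComplex A ℤ} (f : C ⟶ D) : (mappingCone f).Acyclic ↔ QuasiIso f := by
  rw [← HomotopyCategory.quotient_obj_mem_subcategoryAcyclic_iff_acyclic,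
    ← HomologicalComplex.mem_quasiIso_iff, ← HomotopyCategory.quotient_map_mem_quasiIso_iff,
    HomotopyCategory.quasiIso_eq_trW_subcategoryAcyclic]
  exact (ObjectProperty.trW_iff_of_distinguished _ _
    (HomotopyCategory.mappingCone_triangleh_distinguished f)).symm

/-- The identity of an acyclic K-projective cone is null-homotopic, so the cone is zero in the
homotopy category and `f` is invertible there. -/
theorem CochainComplex.exists_homotopyEquiv_of_acyclic_mappingCone {A : Type*} [Category* A]
    [Abelian A] {C D : CochainComplex A ℤ} (f : C ⟶ D) [(mappingCone f).IsKProjective]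
    (h : (mappingCone f).Acyclic) : ∃ e : HomotopyEquiv C D, e.hom = f := by
  have hz : Limits.IsZero ((HomotopyCategory.quotient A (.up ℤ)).obj (mappingCone f)) := by
    rw [Limits.IsZero.iff_id_eq_zero, ← CategoryTheory.Functor.map_id,
      HomotopyCategory.eq_of_homotopy _ 0 (IsKProjective.homotopyZero (𝟙 (mappingCone f)) h),
      Functor.map_zero]
  have hiso : IsIso ((HomotopyCategory.quotient A (.up ℤ)).map f) :=
    (Pretriangulated.Triangle.isZero₃_iff_isIso₁ _
      (HomotopyCategory.mappingCone_triangleh_distinguished f)).1 hz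
  obtain ⟨g, hg⟩ := (HomotopyCategory.quotient A (.up ℤ)).map_surjective
    (inv ((HomotopyCategory.quotient A (.up ℤ)).map f))
  exact ⟨{ hom := f
           inv := g
           homotopyHomInvId := HomotopyCategory.homotopyOfEq _ _ (by simp [hg])
           homotopyInvHomId := HomotopyCategory.homotopyOfEq _ _ (by simp [hg]) }, rfl⟩

theorem corollary4 {p : ℕ} [Fact p.Prime] {P : Type u} [Group P] [Finite P] (hP : IsPGroup p P)
    (C D : CochainComplex (CoeffSystem.{v} (ZMod p) P) ℤ)
    (hC : IsBoundedComplex C) (hD : IsBoundedComplex D)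
    (hCproj : ∀ n : ℤ, Projective (C.X n)) (hDproj : ∀ n : ℤ, Projective (D.X n))
    (f : C ⟶ D)
    (hf : QuasiIso (((CoeffSystem.evalAt (ZMod p) (⊥ : Subgroup P)).mapHomologicalComplex
      (ComplexShape.up ℤ)).map f)) :
    ∃ e : HomotopyEquiv C D, e.hom = f := by
  obtain ⟨a, b, hab⟩ := hC
  obtain ⟨a', b', hab'⟩ := hD
  let T := CochainComplex.mappingCone f
  have hX : ∀ n, T.X n ≅ C.X (n + 1) ⊞ D.X n := fun n =>
    HomologicalComplex.homotopyCofiber.XIsoBiprod f n (n + 1) rfl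
  have hTproj : ∀ n, Projective (T.X n) := fun n => Projective.of_iso (hX n).symm inferInstance
  have hT0 : ∀ n, Limits.IsZero (C.X (n + 1)) → Limits.IsZero (D.X n) →
      Limits.IsZero (T.X n) := fun n h h' =>
    ((Limits.biprod_isZero_iff _ _).2 ⟨h, h'⟩).of_iso (hX n)
  -- Evaluation at `H` is additive, so it commutes with mapping cones.
  have hcone : ∀ H : Subgroup P,
      (((CoeffSystem.evalAt (ZMod p) H).mapHomologicalComplex _).obj T).Acyclic ↔
      QuasiIso (((CoeffSystem.evalAt (ZMod p) H).mapHomologicalComplex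
        (ComplexShape.up ℤ)).map f) := fun H => by
    rw [← CochainComplex.acyclic_mappingCone_iff]
    let e := CochainComplex.mappingCone.mapHomologicalComplexIso f (CoeffSystem.evalAt (ZMod p) H)
    exact ⟨fun h n => (h n).of_iso e, fun h n => (h n).of_iso e.symm⟩
  have hq : QuasiIso f := by
    rw [HomologicalComplex.quasiIso_iff_evaluation]
    rintro ⟨⟨H⟩⟩
    -- The bound `a - 1` comes from the shift: `T.X n` contains `C.X (n + 1)`.
    refine (hcone H).1 (CoeffSystem.acyclic_evalAt hP T (min (a - 1) a') ?_ hTproj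
      ((hcone ⊥).2 hf) H)
    exact fun n hn => hT0 n (hab _ (by omega)) (hab' _ (by omega))
  have : T.IsStrictlyLE (max b b') := by
    rw [CochainComplex.isStrictlyLE_iff]
    exact fun n hn => hT0 n (hab _ (by omega)) (hab' _ (by omega))
  have : T.IsKProjective := CochainComplex.isKProjective_of_projective T (max b b')
  exact CochainComplex.exists_homotopyEquiv_of_acyclic_mappingCone f
    ((CochainComplex.acyclic_mappingCone_iff f).2 hq)
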